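/- Let $\mathcal G=(\mathcal V,\mathcal E)$ be a strongly connected digraph on $n\ge 1$ agents, where $(i,j)\in\mathcal E$ denotes an edge from $j$ to $i$, let $\mathcal N_i^-=\{j\ne i : (i,j)\in\mathcal E\}$, and let the integer $\mathcal D\ge 0$ be an upper bound on the diameter of $\mathcal G$ (the largest length of a shortest directed path between two nodes). Let $\mathcal P=[p_{ij}]\in\mathbb R^{n\times n}$ be a weight matrix of $\mathcal G$ (that is, $p_{ij}=0$ whenever $i\ne j$ and $(i,j)\notin\mathcal E$) which is column-stochastic ($p_{ij}\ge 0$ and $\sum_i p_{ij}=1$ for every $j$) and primitive (nonnegative, irreducible, and with only one complex eigenvalue of maximum modulus). Let $\|\cdot\|$ be a norm on $\mathbb R^p$. Given arbitrary $u_i^0\in\mathbb R^p$, $i\in\mathcal V$, put $v_i^0=1$, $w_i^0=u_i^0$ and, for $k\ge 0$, $$u_i^{k+1}=p_{ii}u_i^k+\sum_{j\in\mathcal N_i^-}p_{ij}u_j^k,\qquad v_i^{k+1}=p_{ii}v_i^k+\sum_{j\in\mathcal N_i^-}p_{ij}v_j^k,\qquad w_i^{k+1}=\frac{1}{v_i^{k+1}}u_i^{k+1}.$$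 For $s\ge 0$ let $R_i^0(s)=0$ and, for $k\ge 0$, $$R_i^{k+1}(s)=\max_{j\in\mathcal N_i^-}\bigl\{\|w_i^{s+k+1}-w_j^{s+k}\|+R_j^k(s)\bigr\}$$ (for $n=1$, where $\mathcal N_i^-$ is empty, the maximum is read as $0$), and let $\widehat R_i^m=R_i^{\mathcal D}(m\mathcal D)$ for $m=0,1,2,\dots$. Then $$\lim_{m\to\infty}\widehat R_i^m=0\quad\text{for all } i\in\mathcal V.$$ Further, for every $i\in\mathcal V$, $\lim_{m\to\infty}\widehat R_i^m=0$ if and only if $\lim_{m\to\infty}\max_{j,l\in\mathcal V}\|w_j^{m\mathcal D}-w_l^{m\mathcal D}\|=0$. -/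

import Mathlib

open Filter Topology

noncomputable section

/-! Digraphs. `G.Adj j i` says that there is an edge from `j` to `i`. -/

namespace Digraph

variable {V : Type*} (G : Digraph V)

/-- There is a directed walk with exactly `ℓ` edges from `a` to `b`. -/
def HasWalk : ℕ → V → V → Prop
  | 0, a, b => a = b
  | ℓ + 1, a, b => ∃ c, HasWalk ℓ a c ∧ G.Adj c b

/-- For all distinct `a`, `b` there is a directed path from `a` to `b`. -/
def StronglyConnected : Prop :=
  ∀ a b : V, a ≠ b → ∃ ℓ : ℕ, G.HasWalk ℓ a b

/-- Length of a shortest directed path from `a` to `b` (`⊤` if there is none). -/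
def dirDist (a b : V) : ℕ∞ :=
  ⨅ (ℓ : ℕ) (_ : G.HasWalk ℓ a b), (ℓ : ℕ∞)

/-- The diameter: the largest length of a shortest directed path between two nodes. -/
def dirDiam : ℕ∞ :=
  ⨆ (a : V) (b : V), G.dirDist a b

open Classical in
/-- The in-neighbors of `i`: the nodes `j ≠ i` with an edge from `j` to `i`. -/
def inNeighbors [Fintype V] (i : V) : Finset V :=
  Finset.univ.filter fun j => j ≠ i ∧ G.Adj j i

end Digraph

namespace RatioConsensus

variable {V : Type*} [Fintype V]

/-- A real matrix is primitive if it is (nonnegative and) irreducible and exactly one of its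
complex eigenvalues has maximum modulus. -/
structure IsPrimitive [DecidableEq V] (P : Matrix V V ℝ) : Prop where
  /-- `P` is entrywise nonnegative and irreducible. -/
  irreducible : P.IsIrreducible
  /-- Only one eigenvalue has maximum modulus. -/
  unique_max : ∃! z : ℂ,
    Module.End.HasEigenvalue (Matrix.toLin' (P.map (algebraMap ℝ ℂ))) z ∧
      ∀ z' : ℂ, Module.End.HasEigenvalue (Matrix.toLin' (P.map (algebraMap ℝ ℂ))) z' → ‖z'‖ ≤ ‖z‖

/-- `P` is a weight matrix of the digraph `G`: the weight `P i j`, `i ≠ j`, vanishes if there is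
no edge from `j` to `i`. The diagonal is not restricted. -/
def IsWeightMatrix (G : Digraph V) (P : Matrix V V ℝ) : Prop :=
  ∀ i j : V, i ≠ j → ¬ G.Adj j i → P i j = 0

variable {E : Type*} [NormedAddCommGroup E] [NormedSpace ℝ E]

/-- The iterates `x i (k+1) = p i i • x i k + ∑ p i j • x j k`, the sum being over the in-neighbors
`j` of `i`; the first argument of the resulting function is the time `k`. -/
def mix (G : Digraph V) (P : Matrix V V ℝ) (x₀ : V → E) : ℕ → V → E
  | 0 => x₀
  | k + 1 => fun i => P i i • mix G P x₀ k i + ∑ j ∈ G.inNeighbors i, P i j • mix G P x₀ k j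

/-- The numerator states `u i k`. -/
def u (G : Digraph V) (P : Matrix V V ℝ) (u₀ : V → E) : ℕ → V → E :=
  mix G P u₀

/-- The denominator states `v i k`, started at `1`. -/
def v (G : Digraph V) (P : Matrix V V ℝ) : ℕ → V → ℝ :=
  mix G P fun _ => (1 : ℝ)

/-- The ratio-consensus states `w i k`. -/
def w (G : Digraph V) (P : Matrix V V ℝ) (u₀ : V → E) : ℕ → V → E
  | 0 => u₀
  | k + 1 => fun i => (1 / v G P (k + 1) i) • u G P u₀ (k + 1) i

/-- The radii `R i k (s)` of the max-radius update started at time `s` along the states `x`: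
`R i 0 (s) = 0` and `R i (k+1) (s)` is the maximum over the in-neighbors `j` of `i` of
`‖x i (s+k+1) - x j (s+k)‖ + R j k (s)`. (If `i` has no in-neighbor, the maximum is `0`.) -/
def radius (G : Digraph V) (x : ℕ → V → E) (s : ℕ) : ℕ → V → ℝ
  | 0 => fun _ => 0
  | k + 1 => fun i =>
      ⨆ j : G.inNeighbors i, (‖x (s + k + 1) i - x (s + k) j‖ + radius G x s k j)

/-- The radii at the end of the windows: `Rhat i m = R i D (m * D)`. -/
def Rhat (G : Digraph V) (P : Matrix V V ℝ) (u₀ : V → E) (D : ℕ) (m : ℕ) (i : V) : ℝ :=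
  radius G (w G P u₀) (m * D) D i

/-- The maximum pairwise disagreement of the states `x`. -/
def disagreement (x : V → E) : ℝ :=
  ⨆ q : V × V, ‖x q.1 - x q.2‖

end RatioConsensus

end

/-! Ratio consensus converges: every state tends to the average of the initial values, so both sides
of the equivalence hold outright. The fixed space of an irreducible column-stochastic `P` is spanned
by a positive `π` of sum one, and primitivity puts the eigenvalues other than `1` in the open unit
disc. Gelfand's formula, applied to `P` minus the rank-one matrix with all columns `π`, shows that
`P ^ k` tends to that matrix (`tendsto_pow_stationary`). Numerators and denominators therefore have
limits proportional to `π i`, which cancels in the ratio (`tendsto_w`). Radii over a fixed window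
are built from finitely many differences of states, so they vanish (`tendsto_radius`). -/

namespace RatioConsensus

/-! ### Gelfand's formula and decay of powers -/

section Gelfand

/-- The powers of an element of spectral radius less than one tend to zero. -/
theorem tendsto_pow_of_spectralRadius_lt_one {A : Type*} [NormedRing A] [NormedAlgebra ℂ A]
    [CompleteSpace A] {a : A} (ha : spectralRadius ℂ a < 1) :
    Tendsto (fun k : ℕ => a ^ k) atTop (𝓝 0) := by
  obtain ⟨r, hr, hr1⟩ := exists_between ha
  have h := spectrum.pow_nnnorm_pow_one_div_tendsto_nhds_spectralRadius a
  rw [tendsto_zero_iff_enorm_tendsto_zero]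
  refine tendsto_of_tendsto_of_tendsto_of_le_of_le' tendsto_const_nhds
    (ENNReal.tendsto_pow_atTop_nhds_zero_of_lt_one hr1) (Eventually.of_forall fun _ => zero_le) ?_
  filter_upwards [h.eventually_lt_const hr, eventually_gt_atTop 0] with k hk hk0
  have hk' : (k : ℝ) ≠ 0 := by positivity
  calc ‖a ^ k‖ₑ = ((‖a ^ k‖₊ : ENNReal) ^ (1 / (k : ℝ))) ^ (k : ℝ) := by
        rw [← ENNReal.rpow_mul, one_div_mul_cancel hk', ENNReal.rpow_one]; rfl
    _ ≤ r ^ (k : ℝ) := ENNReal.rpow_le_rpow hk.le (by positivity)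
    _ = r ^ k := ENNReal.rpow_natCast r k

attribute [local instance] Matrix.linftyOpNormedRing Matrix.linftyOpNormedAlgebra in
/-- The powers of a complex matrix whose spectrum lies in the open unit disc tend to zero. -/
theorem tendsto_matrix_pow_zero {V : Type*} [Fintype V] [DecidableEq V] [Nonempty V]
    {Q : Matrix V V ℂ} (hQ : ∀ z ∈ spectrum ℂ Q, ‖z‖ < 1) (i j : V) :
    Tendsto (fun k : ℕ => (Q ^ k) i j) atTop (𝓝 0) := by
  have : CompleteSpace (Matrix V V ℂ) := FiniteDimensional.complete ℂ _
  -- The spectral radius is attained, so the strict pointwise bound survives the supremum.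
  obtain ⟨z, hz, hzr⟩ := spectrum.exists_nnnorm_eq_spectralRadius Q
  have h1 : spectralRadius ℂ Q < 1 := by
    rw [← hzr]
    exact_mod_cast hQ z hz
  have h := tendsto_pow_of_spectralRadius_lt_one h1
  have hc : Continuous fun M : Matrix V V ℂ => M i j := by fun_prop
  exact (hc.tendsto 0).comp h

end Gelfand

/-! ### Perron–Frobenius theory for column-stochastic matrices -/

section Stochastic

open Matrix

variable {V : Type*} [Fintype V] [DecidableEq V] {P : Matrix V V ℝ}

theorem pow_mulVec_eq_self {x : V → ℝ} (hx : P *ᵥ x = x) (k : ℕ) : (P ^ k) *ᵥ x = x := by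
  induction k with
  | zero => simp
  | succ k ih => rw [pow_succ, ← mulVec_mulVec, hx, ih]

/-- A nonzero nonnegative fixed vector of an irreducible matrix is positive. -/
theorem pos_of_mulVec_eq_self (hP : P.IsIrreducible) {x : V → ℝ} (hx : P *ᵥ x = x)
    (hx0 : ∀ i, 0 ≤ x i) (hne : x ≠ 0) (i : V) : 0 < x i := by
  obtain ⟨j, hj⟩ := Function.ne_iff.1 hne
  have hj' : 0 < x j := lt_of_le_of_ne (hx0 j) (Ne.symm hj)
  obtain ⟨k, -, hk⟩ := (isIrreducible_iff_exists_pow_pos hP.nonneg).1 hP i j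
  calc 0 < (P ^ k) i j * x j := mul_pos hk hj'
    _ ≤ ∑ l, (P ^ k) i l * x l := Finset.single_le_sum (f := fun l => (P ^ k) i l * x l)
        (fun l _ => mul_nonneg (pow_apply_nonneg hP.nonneg k i l) (hx0 l)) (Finset.mem_univ j)
    _ = x i := congrFun (pow_mulVec_eq_self hx k) i

/-- The triangle inequality gives `|x| ≤ P|x|` entrywise; unit column sums give both sides the same
total, forcing equality. -/
theorem mulVec_abs_eq_self (hcol : P ∈ colStochastic ℝ V) {x : V → ℝ} (hx : P *ᵥ x = x) :
    P *ᵥ (fun i => |x i|) = fun i => |x i| := by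
  have hle : ∀ i ∈ Finset.univ, |x i| ≤ (P *ᵥ fun i => |x i|) i := by
    intro i _
    calc |x i| = |∑ j, P i j * x j| := congrArg abs (congrFun hx i).symm
      _ ≤ ∑ j, |P i j * x j| := Finset.abs_sum_le_sum_abs _ _
      _ = ∑ j, P i j * |x j| := by
          simp_rw [abs_mul, abs_of_nonneg (nonneg_of_mem_colStochastic hcol)]
  have hsum := sum_mulVec_of_mem_colStochastic hcol (x := fun i => |x i|)
  funext i
  exact ((Finset.sum_eq_sum_iff_of_le hle).1 hsum.symm i (Finset.mem_univ i)).symm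

/-- The fixed vectors of an irreducible column-stochastic matrix are determined by their sum. -/
theorem eq_zero_of_mulVec_eq_self (hP : P.IsIrreducible) (hcol : P ∈ colStochastic ℝ V)
    {x : V → ℝ} (hx : P *ᵥ x = x) (hsum : ∑ i, x i = 0) : x = 0 := by
  by_contra hne
  have habs := mulVec_abs_eq_self hcol hx
  have hpos : ∀ i, 0 < |x i| := pos_of_mulVec_eq_self hP habs (fun i => abs_nonneg _) fun h =>
    hne (funext fun i => abs_eq_zero.1 (congrFun h i))
  obtain ⟨i₀, -⟩ := Function.ne_iff.1 hne
  -- The fixed vector `|x| + x` is nonnegative, hence zero or positive everywhere; so `x` has one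
  -- strict sign, against its zero sum.
  have hy : P *ᵥ ((fun i => |x i|) + x) = (fun i => |x i|) + x := by rw [mulVec_add, habs, hx]
  by_cases hy0 : (fun i => |x i|) + x = 0
  · have hneg : ∀ i, x i < 0 := fun i => by
      have h1 := congrFun hy0 i
      simp only [Pi.add_apply, Pi.zero_apply] at h1
      linarith [hpos i]
    exact (Finset.sum_neg (fun i _ => hneg i) ⟨i₀, Finset.mem_univ i₀⟩).ne hsum
  · have hy1 := pos_of_mulVec_eq_self hP hy (fun i => by
      simp only [Pi.add_apply]; linarith [neg_abs_le (x i)]) hy0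
    have hxpos : ∀ i, 0 < x i := fun i => by
      by_contra hi
      have h1 := hy1 i
      simp only [Pi.add_apply, abs_of_nonpos (not_lt.1 hi)] at h1
      linarith
    exact (Finset.sum_pos (fun i _ => hxpos i) ⟨i₀, Finset.mem_univ i₀⟩).ne' hsum

/-- The all-ones vector is a left fixed vector, so `P - 1` is singular and has a right kernel too.
-/
theorem exists_mulVec_eq_self_ne_zero [Nonempty V] (hcol : P ∈ colStochastic ℝ V) :
    ∃ x : V → ℝ, x ≠ 0 ∧ P *ᵥ x = x := by
  have hdet : (P - 1).det = 0 := exists_vecMul_eq_zero_iff.1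
    ⟨1, one_ne_zero, by rw [vecMul_sub, one_vecMul_of_mem_colStochastic hcol, vecMul_one, sub_self]⟩
  obtain ⟨x, hx, h⟩ := exists_mulVec_eq_zero_iff.2 hdet
  exact ⟨x, hx, by rwa [sub_mulVec, one_mulVec, sub_eq_zero] at h⟩

/-- An irreducible column-stochastic matrix has a positive stationary distribution. -/
theorem exists_stationary [Nonempty V] (hP : P.IsIrreducible) (hcol : P ∈ colStochastic ℝ V) :
    ∃ π : V → ℝ, (∀ i, 0 < π i) ∧ ∑ i, π i = 1 ∧ P *ᵥ π = π := by
  obtain ⟨x, hx0, hx⟩ := exists_mulVec_eq_self_ne_zero hcol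
  have habs := mulVec_abs_eq_self hcol hx
  have hpos : ∀ i, 0 < |x i| := pos_of_mulVec_eq_self hP habs (fun i => abs_nonneg _) fun h =>
    hx0 (funext fun i => abs_eq_zero.1 (congrFun h i))
  have hS : 0 < ∑ i, |x i| := Finset.sum_pos (fun i _ => hpos i) Finset.univ_nonempty
  refine ⟨(∑ i, |x i|)⁻¹ • fun i => |x i|, fun i => mul_pos (inv_pos.2 hS) (hpos i), ?_, ?_⟩
  · simp only [Pi.smul_apply, smul_eq_mul, ← Finset.mul_sum]
    exact inv_mul_cancel₀ hS.ne'
  · rw [mulVec_smul, habs]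

theorem hasEigenvalue_toLin'_iff {A : Matrix V V ℂ} {z : ℂ} :
    Module.End.HasEigenvalue (toLin' A) z ↔ ∃ x ≠ 0, A *ᵥ x = z • x := by
  constructor
  · intro h
    obtain ⟨x, hx⟩ := h.exists_hasEigenvector
    exact ⟨x, hx.2, by simpa using hx.apply_eq_smul⟩
  · rintro ⟨x, hx0, hx⟩
    exact Module.End.hasEigenvalue_of_hasEigenvector (x := x)
      ⟨Module.End.mem_eigenspace_iff.2 (by simpa using hx), hx0⟩

/-- The complexification of a column-stochastic matrix preserves sums. -/
theorem sum_map_mulVec (hcol : P ∈ colStochastic ℝ V) (x : V → ℂ) :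
    ∑ i, (P.map (algebraMap ℝ ℂ) *ᵥ x) i = ∑ i, x i := by
  simp only [mulVec, dotProduct, map_apply]
  rw [Finset.sum_comm]
  refine Finset.sum_congr rfl fun j _ => ?_
  rw [← Finset.sum_mul, ← map_sum, sum_col_of_mem_colStochastic hcol, map_one, one_mul]

/-- A column-stochastic matrix does not increase the `ℓ¹` norm. -/
theorem norm_le_one_of_hasEigenvalue (hcol : P ∈ colStochastic ℝ V) {z : ℂ}
    (hz : Module.End.HasEigenvalue (toLin' (P.map (algebraMap ℝ ℂ))) z) : ‖z‖ ≤ 1 := by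
  obtain ⟨x, hx0, hx⟩ := hasEigenvalue_toLin'_iff.1 hz
  obtain ⟨i₀, hi₀⟩ := Function.ne_iff.1 hx0
  have hS : 0 < ∑ i, ‖x i‖ := Finset.sum_pos' (fun i _ => norm_nonneg _)
    ⟨i₀, Finset.mem_univ _, norm_pos_iff.2 hi₀⟩
  have h : ‖z‖ * ∑ i, ‖x i‖ ≤ 1 * ∑ i, ‖x i‖ := by
    calc ‖z‖ * ∑ i, ‖x i‖ = ∑ i, ‖∑ j, (P i j : ℂ) * x j‖ := by
          rw [Finset.mul_sum]
          refine Finset.sum_congr rfl fun i _ => ?_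
          rw [← norm_mul]
          exact congrArg norm (congrFun hx i).symm
      _ ≤ ∑ i, ∑ j, P i j * ‖x j‖ := Finset.sum_le_sum fun i _ => by
          refine (norm_sum_le _ _).trans_eq (Finset.sum_congr rfl fun j _ => ?_)
          rw [norm_mul, Complex.norm_real, Real.norm_of_nonneg (nonneg_of_mem_colStochastic hcol)]
      _ = 1 * ∑ i, ‖x i‖ := by
          rw [one_mul]
          exact sum_mulVec_of_mem_colStochastic hcol (x := fun i => ‖x i‖)
  exact le_of_mul_le_mul_right h hS

theorem map_mulVec_ofReal {V : Type*} [Fintype V] {P : Matrix V V ℝ} (x : V → ℝ) :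
    P.map (algebraMap ℝ ℂ) *ᵥ (fun i => (x i : ℂ)) = fun i => ((P *ᵥ x) i : ℂ) := by
  funext i
  simp [mulVec, dotProduct]

theorem hasEigenvalue_one [Nonempty V] (hcol : P ∈ colStochastic ℝ V) :
    Module.End.HasEigenvalue (toLin' (P.map (algebraMap ℝ ℂ))) 1 := by
  obtain ⟨x, hx0, hx⟩ := exists_mulVec_eq_self_ne_zero hcol
  refine hasEigenvalue_toLin'_iff.2 ⟨fun i => (x i : ℂ), fun h => hx0 (funext fun i => ?_), ?_⟩
  · exact Complex.ofReal_eq_zero.1 (congrFun h i)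
  · rw [map_mulVec_ofReal, hx, one_smul]

/-- The eigenvalues other than `1` of a primitive column-stochastic matrix have modulus less
than one. -/
theorem norm_lt_one_of_hasEigenvalue [Nonempty V] (hprim : IsPrimitive P)
    (hcol : P ∈ colStochastic ℝ V) {z : ℂ}
    (hz : Module.End.HasEigenvalue (toLin' (P.map (algebraMap ℝ ℂ))) z) (hz1 : z ≠ 1) :
    ‖z‖ < 1 := by
  by_contra h
  have hmax : ∀ y : ℂ, 1 ≤ ‖y‖ → ∀ z' : ℂ,
      Module.End.HasEigenvalue (toLin' (P.map (algebraMap ℝ ℂ))) z' → ‖z'‖ ≤ ‖y‖ :=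
    fun y hy z' hz' => (norm_le_one_of_hasEigenvalue hcol hz').trans hy
  exact hz1 (hprim.unique_max.unique ⟨hz, hmax z (not_lt.1 h)⟩
    ⟨hasEigenvalue_one hcol, hmax 1 (by simp)⟩)

/-- As `P` is real, real and imaginary parts are fixed separately. -/
theorem eq_zero_of_map_mulVec_eq_self (hP : P.IsIrreducible) (hcol : P ∈ colStochastic ℝ V)
    {x : V → ℂ} (hx : P.map (algebraMap ℝ ℂ) *ᵥ x = x) (hsum : ∑ i, x i = 0) : x = 0 := by
  have hre : (fun i => (x i).re) = 0 := by
    refine eq_zero_of_mulVec_eq_self hP hcol (funext fun i => ?_) ?_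
    · have h := congrArg Complex.re (congrFun hx i)
      simpa [mulVec, dotProduct] using h
    · simpa using congrArg Complex.re hsum
  have him : (fun i => (x i).im) = 0 := by
    refine eq_zero_of_mulVec_eq_self hP hcol (funext fun i => ?_) ?_
    · have h := congrArg Complex.im (congrFun hx i)
      simpa [mulVec, dotProduct] using h
    · simpa using congrArg Complex.im hsum
  funext i
  exact Complex.ext (congrFun hre i) (congrFun him i)

/-- The powers of a primitive column-stochastic matrix converge to the matrix whose columns are
all equal to its stationary distribution. -/
theorem tendsto_pow_stationary [Nonempty V] (hprim : IsPrimitive P) (hcol : P ∈ colStochastic ℝ V)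
    {π : V → ℝ} (hsum : ∑ i, π i = 1) (hfix : P *ᵥ π = π) (i j : V) :
    Tendsto (fun k : ℕ => (P ^ k) i j) atTop (𝓝 (π i)) := by
  set R : Matrix V V ℝ := vecMulVec π 1 with hR
  have hPR : P * R = R := by rw [hR, mul_vecMulVec, hfix]
  have hRP : R * P = R := by rw [hR, vecMulVec_mul, one_vecMul_of_mem_colStochastic hcol]
  have hRR : R * R = R := by
    rw [hR, vecMulVec_mul_vecMulVec]
    simp [dotProduct, hsum]
  -- The exponent starts at one: the zeroth power would be `1`, not `1 - R`.
  have hpow : ∀ k : ℕ, (P - R) ^ (k + 1) = P ^ (k + 1) - R := by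
    intro k
    induction k with
    | zero => simp
    | succ k ih =>
      have hPkR : P ^ (k + 1) * R = R := by
        clear ih
        induction k with
        | zero => simpa using hPR
        | succ k ih => rw [pow_succ, mul_assoc, hPR, ih]
      rw [pow_succ, ih, sub_mul, mul_sub, mul_sub, hPkR, hRP, hRR, ← pow_succ]
      abel
  -- The columns of `P - R` sum to zero, so an eigenvector for `z ≠ 0` has zero sum. Then `R` kills
  -- it, and it is an eigenvector of `P` with `z ≠ 1`.
  have hspec : ∀ z ∈ spectrum ℂ ((P - R).map (algebraMap ℝ ℂ)), ‖z‖ < 1 := by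
    intro z hz
    rw [← spectrum_toLin', ← Module.End.hasEigenvalue_iff_mem_spectrum] at hz
    obtain ⟨x, hx0, hx⟩ := hasEigenvalue_toLin'_iff.1 hz
    rcases eq_or_ne z 0 with rfl | hz0
    · simp
    have hRx : R.map (algebraMap ℝ ℂ) *ᵥ x = fun i => (π i : ℂ) * ∑ j, x j := by
      funext i
      simp [hR, mulVec, dotProduct, Finset.mul_sum]
    have hsplit : P.map (algebraMap ℝ ℂ) *ᵥ x = z • x + fun i => (π i : ℂ) * ∑ j, x j := by
      rw [← hRx, ← hx, ← add_mulVec]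
      congr 1
      ext i j
      simp
    have hπ : ∑ i, (π i : ℂ) = 1 := by exact_mod_cast hsum
    have hxs : ∑ j, x j = 0 := by
      have h := sum_map_mulVec hcol x
      rw [hsplit] at h
      simp only [Pi.add_apply, Pi.smul_apply, smul_eq_mul, Finset.sum_add_distrib,
        ← Finset.mul_sum, ← Finset.sum_mul, hπ, one_mul] at h
      exact (mul_eq_zero.1 (by linear_combination h)).resolve_left hz0
    have hPx : P.map (algebraMap ℝ ℂ) *ᵥ x = z • x := by
      rw [hsplit, hxs]
      simp [funext_iff]
    refine norm_lt_one_of_hasEigenvalue hprim hcol (hasEigenvalue_toLin'_iff.2 ⟨x, hx0, hPx⟩) ?_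
    rintro rfl
    exact hx0 (eq_zero_of_map_mulVec_eq_self hprim.irreducible hcol (by rwa [one_smul] at hPx) hxs)
  have hlim : Tendsto (fun k : ℕ => ((P - R) ^ k) i j) atTop (𝓝 0) := by
    have h := (Complex.continuous_re.tendsto _).comp (tendsto_matrix_pow_zero hspec i j)
    refine h.congr fun k => ?_
    have hk : ((P - R).map (algebraMap ℝ ℂ)) ^ k = ((P - R) ^ k).map (algebraMap ℝ ℂ) :=
      (map_pow (algebraMap ℝ ℂ).mapMatrix (P - R) k).symm
    rw [Function.comp_apply, hk, map_apply]
    exact Complex.ofReal_re _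
  rw [← tendsto_add_atTop_iff_nat 1] at hlim ⊢
  have h := hlim.add_const (π i)
  rw [zero_add] at h
  refine h.congr fun k => ?_
  rw [hpow, Matrix.sub_apply, hR, vecMulVec_apply, Pi.one_apply, mul_one, sub_add_cancel]

end Stochastic

/-! ### Limits of radii and disagreements -/

section Radius

variable {V : Type*} [Fintype V] {E : Type*} [NormedAddCommGroup E]

/-- The sum dominates the supremum, also over an empty index type, where both are zero. -/
theorem tendsto_iSup_zero {α ι : Type*} [Fintype ι] {l : Filter α} {f : ι → α → ℝ}
    (hf0 : ∀ i a, 0 ≤ f i a) (hf : ∀ i, Tendsto (f i) l (𝓝 0)) :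
    Tendsto (fun a => ⨆ i, f i a) l (𝓝 0) := by
  have h := tendsto_finsetSum Finset.univ fun i (_ : i ∈ Finset.univ) => hf i
  rw [Finset.sum_const_zero] at h
  exact squeeze_zero (fun a => Real.iSup_nonneg fun i => hf0 i a)
    (fun a => Real.iSup_le (fun i => Finset.single_le_sum (f := fun i => f i a)
      (fun j _ => hf0 j a) (Finset.mem_univ i)) (Finset.sum_nonneg fun j _ => hf0 j a)) h

theorem radius_nonneg (G : Digraph V) (x : ℕ → V → E) (s k : ℕ) (i : V) :
    0 ≤ radius G x s k i := by
  induction k generalizing i with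
  | zero => exact le_rfl
  | succ k ih => exact Real.iSup_nonneg fun j => add_nonneg (norm_nonneg _) (ih j)

/-- If all states converge to the same limit, the radii over windows of a fixed length vanish. -/
theorem tendsto_radius {G : Digraph V} {x : ℕ → V → E} {c : E} (hx : ∀ i, Tendsto (fun s => x s i) atTop (𝓝 c))
    (k : ℕ) (i : V) : Tendsto (fun s => radius G x s k i) atTop (𝓝 0) := by
  induction k generalizing i with
  | zero => exact tendsto_const_nhds
  | succ k ih =>
    simp only [radius]
    refine tendsto_iSup_zero
      (fun j s => add_nonneg (norm_nonneg _) (radius_nonneg G x s k j)) fun j => ?_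
    have h1 := (tendsto_add_atTop_iff_nat (k + 1)).2 (hx i)
    have h2 := (tendsto_add_atTop_iff_nat k).2 (hx j)
    simpa [add_assoc] using (h1.sub h2).norm.add (ih j)

theorem tendsto_disagreement {x : ℕ → V → E} {c : E}
    (hx : ∀ i, Tendsto (fun s => x s i) atTop (𝓝 c)) :
    Tendsto (fun s => disagreement (x s)) atTop (𝓝 0) := by
  simp only [disagreement]
  refine tendsto_iSup_zero (fun q s => norm_nonneg _) fun q => ?_
  simpa using ((hx q.1).sub (hx q.2)).norm

/-- Distinct nodes are at distance at least one. This serves `D = 0`, where the time `m * D` never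
advances and the disagreement must vanish from the start. -/
theorem subsingleton_of_dirDiam_le_zero {V : Type*} {G : Digraph V} (h : G.dirDiam ≤ 0) : Subsingleton V := by
  refine ⟨fun a b => ?_⟩
  by_contra hab
  have h1 : (1 : ℕ∞) ≤ G.dirDist a b := le_iInf₂ fun ℓ hℓ => by
    cases ℓ with
    | zero => exact absurd hℓ hab
    | succ ℓ => exact_mod_cast Nat.succ_le_succ (Nat.zero_le ℓ)
  have h2 : G.dirDist a b ≤ G.dirDiam := le_iSup₂ (f := fun a b => G.dirDist a b) a b
  exact absurd (h1.trans (h2.trans h)) (by simp)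

theorem disagreement_of_subsingleton {V : Type*} [Subsingleton V] (x : V → E) : disagreement x = 0 := by
  have h : ∀ q : V × V, ‖x q.1 - x q.2‖ = 0 := fun q => by
    rw [Subsingleton.elim q.1 q.2, sub_self, norm_zero]
  simp [disagreement, h]

end Radius

/-! ### Convergence of ratio consensus -/

section Consensus

variable {V : Type*} [Fintype V] [DecidableEq V]
  {E : Type*} [NormedAddCommGroup E] [NormedSpace ℝ E] {G : Digraph V} {P : Matrix V V ℝ}

theorem mix_succ_eq_sum (hPG : IsWeightMatrix G P) (x₀ : V → E) (k : ℕ) (i : V) :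
    mix G P x₀ (k + 1) i = ∑ j, P i j • mix G P x₀ k j := by
  rw [← Finset.add_sum_erase _ _ (Finset.mem_univ i)]
  simp only [mix]
  congr 1
  refine Finset.sum_subset (fun j hj => ?_) fun j hj hj' => ?_
  · simp only [Digraph.inNeighbors, Finset.mem_filter] at hj
    simp [hj.2.1]
  · have hji : j ≠ i := by simpa using hj
    have hadj : ¬ G.Adj j i := fun h => hj' (by simp [Digraph.inNeighbors, hji, h])
    rw [hPG i j hji.symm hadj, zero_smul]

theorem mix_eq_sum_pow (hPG : IsWeightMatrix G P) (x₀ : V → E) (k : ℕ) (i : V) :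
    mix G P x₀ k i = ∑ j, (P ^ k) i j • x₀ j := by
  induction k generalizing i with
  | zero => simp [mix, Matrix.one_apply]
  | succ k ih =>
    rw [mix_succ_eq_sum hPG, pow_succ']
    simp only [ih, Matrix.mul_apply, Finset.smul_sum, Finset.sum_smul, smul_smul]
    exact Finset.sum_comm

theorem tendsto_mix [Nonempty V] (hPG : IsWeightMatrix G P) (hprim : IsPrimitive P)
    (hcol : P ∈ Matrix.colStochastic ℝ V) {π : V → ℝ} (hsum : ∑ i, π i = 1)
    (hfix : P.mulVec π = π) (x₀ : V → E) (i : V) :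
    Tendsto (fun k => mix G P x₀ k i) atTop (𝓝 (π i • ∑ j, x₀ j)) := by
  simp only [mix_eq_sum_pow hPG, Finset.smul_sum]
  exact tendsto_finsetSum _ fun j _ =>
    (tendsto_pow_stationary hprim hcol hsum hfix i j).smul_const (x₀ j)

/-- Ratio consensus: all states converge to the average of the initial states. -/
theorem tendsto_w (hPG : IsWeightMatrix G P) (hprim : IsPrimitive P)
    (hcol : P ∈ Matrix.colStochastic ℝ V) (u₀ : V → E) (i : V) :
    Tendsto (fun k => w G P u₀ k i) atTop (𝓝 ((Fintype.card V : ℝ)⁻¹ • ∑ j, u₀ j)) := by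
  have : Nonempty V := ⟨i⟩
  obtain ⟨π, hpos, hsum, hfix⟩ := exists_stationary hprim.irreducible hcol
  have hu := tendsto_mix hPG hprim hcol hsum hfix u₀ i
  have hv := tendsto_mix hPG hprim hcol hsum hfix (fun _ : V => (1 : ℝ)) i
  have hcard : (Fintype.card V : ℝ) ≠ 0 := by exact_mod_cast Fintype.card_ne_zero
  have hlim : π i • ∑ _j : V, (1 : ℝ) = π i * Fintype.card V := by simp
  rw [hlim] at hv
  -- Only the limit of the denominators must be nonzero; their values at finite times do not matter.
  have h := (hv.inv₀ (mul_ne_zero (hpos i).ne' hcard)).smul hu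
  rw [smul_smul, mul_inv, mul_right_comm, inv_mul_cancel₀ (hpos i).ne', one_mul] at h
  rw [← tendsto_add_atTop_iff_nat 1] at h ⊢
  refine h.congr fun k => ?_
  simp only [w, u, v, one_div]

end Consensus

end RatioConsensus

theorem theorem3p2 {V : Type*} [Fintype V] [DecidableEq V]
    {E : Type*} [NormedAddCommGroup E] [NormedSpace ℝ E] [FiniteDimensional ℝ E]
    (G : Digraph V) (hG : G.StronglyConnected)
    (D : ℕ) (hD : G.dirDiam ≤ (D : ℕ∞))
    (P : Matrix V V ℝ) (hPG : RatioConsensus.IsWeightMatrix G P)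
    (hprim : RatioConsensus.IsPrimitive P) (hcol : P ∈ Matrix.colStochastic ℝ V)
    (u₀ : V → E) :
    (∀ i : V, Tendsto (fun m : ℕ => RatioConsensus.Rhat G P u₀ D m i) atTop (𝓝 0)) ∧
    (∀ i : V, Tendsto (fun m : ℕ => RatioConsensus.Rhat G P u₀ D m i) atTop (𝓝 0) ↔
      Tendsto (fun m : ℕ => RatioConsensus.disagreement (RatioConsensus.w G P u₀ (m * D)))
        atTop (𝓝 0)) := by
  have hw := RatioConsensus.tendsto_w hPG hprim hcol u₀
  have hR : ∀ i : V, Tendsto (fun m : ℕ => RatioConsensus.Rhat G P u₀ D m i) atTop (𝓝 0) := by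
    intro i
    -- For `D = 0` the radius is its initial value zero; otherwise `m * D` tends to infinity.
    rcases Nat.eq_zero_or_pos D with rfl | hD0
    · exact tendsto_const_nhds
    · exact (RatioConsensus.tendsto_radius hw D i).comp (tendsto_id.atTop_mul_const' hD0)
  have hdis : Tendsto (fun m : ℕ => RatioConsensus.disagreement
      (RatioConsensus.w G P u₀ (m * D))) atTop (𝓝 0) := by
    rcases Nat.eq_zero_or_pos D with rfl | hD0
    · have := RatioConsensus.subsingleton_of_dirDiam_le_zero hD
      simp only [RatioConsensus.disagreement_of_subsingleton]
      exact tendsto_const_nhds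
    · exact (RatioConsensus.tendsto_disagreement hw).comp (tendsto_id.atTop_mul_const' hD0)
  exact ⟨hR, fun i => iff_of_true (hR i) hdis⟩
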